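/- **Optimal wall-clock design for accelerated zeroth-order SGD under adversarial noise.** Setting. Accelerated zeroth-order SGD minimizes $f(x)=\mathbb{E}_\zeta f(x,\zeta)$ on $\mathbb{R}^d$ from values $f(x,\zeta)+\xi(x)$ with deterministic adversarial noise $|\xi(x)|\le\delta$. It uses $N\ge1$ iterations, batches of $B\ge1$ two-point kernel gradient estimates with smoothing radius $h>0$, and uniform fidelity $\delta>0$. Put $Q:=BN$. Let $d\ge1$, $\beta\ge2$, $\gamma>0$. Let $L,R,\sigma_*>0$ be the smoothness constant, the initial distance to the minimizer and the gradient noise level at the minimizer. Let $K\in L^2([-1,1])$ be a smoothing kernel: $\int_{-1}^1K(r)\,dr=0$, $\int_{-1}^1 rK(r)\,dr=1$, $\int_{-1}^1|r|^\beta|K(r)|\,dr<\infty$ and, if $\beta>2$, $\int_{-1}^1r^jK(r)\,dr=0$ for $2\le j\le\lfloor\beta\rfloor$. Put $\kappa=\int_{-1}^1|K(u)|^2du$ and $\kappa_\beta=\int_{-1}^1|u|^\beta|K(u)|\,du$. The objects optimized are the error bound of the method, $$\mathcal E(N,B,\delta,h)=\frac{LR^2}{N^2}+\frac{LR^2}{Q}+\frac{R}{\sqrt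 Q}\Big(\sqrt{d\kappa\sigma_*}+\sqrt{d\kappa Lh}+\sqrt{\kappa\tfrac{d\delta}{h}}\Big)+\underbrace{R\Big(\kappa_\beta Lh^{\beta-1}+\frac{d\delta}{h}\Big)}_{(I)}+\underbrace{N\Big(\kappa_\beta^2Lh^{2(\beta-1)}+\frac{d^2\delta^2}{Lh^2}\Big)}_{(II)},$$ and the wall-clock time $T_{\rm total}=B\sum_{k=1}^Nc(\delta)=Q\,\delta^{-\gamma}$ with query cost $c(\Delta)=\Delta^{-\gamma}$. A design $(N,B,\delta,h)$, with $N,B$ positive integers, is *feasible* for $\varepsilon$ if $\mathcal E(N,B,\delta,h)\le\varepsilon$. Put $h^*(\delta)=\big(\tfrac{d\delta}{\kappa_\beta L}\big)^{1/\beta}$, $p=\tfrac{\beta-1}{\beta}$, $a_1=(\kappa_\beta L)^{1/\beta}d^{(\beta-1)/\beta}$, $a_2=\kappa_\beta^{2/\beta}L^{2/\beta-1}d^{2(\beta-1)/\beta}$. Fix $\nu>0$. The *large-$N$, large-$Q$ regime* consists of the designs with $N\ge\nu LR^2/\varepsilon$ and $LR^2/Q\le R\sqrt{\kappa d\sigma_*}/\sqrt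 Q$. Claim. Below, $x\asymp y$ means $c\,y\le x\le C\,y$ with constants $0<c\le C$ depending only on $\beta,\gamma,\nu$. (a) For $h=h^*(\delta)$ with $\delta>0$, the terms are $(I)=2Ra_1\delta^p$ and $(II)=2Na_2\delta^{2p}$. (b) There is $\varepsilon_0>0$, which may depend on all the data, such that for all $0<\varepsilon\le\varepsilon_0$ the following holds. Among the feasible designs of the large-$N$, large-$Q$ regime with $h=h^*(\delta)$ there is one of minimal wall-clock time, and every such minimizer $(N^*,B^*,\delta^*,h^*)$, with $Q^*=B^*N^*$ and $h^*=h^*(\delta^*)$, satisfies $$N^*\asymp\frac{LR^2}{\varepsilon},\qquad Q^*\asymp\frac{R^2\kappa d\sigma_*}{\varepsilon^2},\qquad B^*\asymp\frac{\kappa d\sigma_*}{L\varepsilon},\qquad \delta^*\asymp\frac{\varepsilon^{\frac{\beta}{\beta-1}}}{d\,\kappa_\beta^{\frac1{\beta-1}}L^{\frac1{\beta-1}}R^{\frac\beta{\beta-1}}},$$ $$T^*_{\rm total}\asymp\frac{\kappa\,\sigma_*\,d^{1+\gamma}\,\kappa_\beta^{\frac\gamma{\beta-1}}L^{\frac\gamma{\beta-1}}R^{2+\frac{\gamma\beta}{\beta-1}}}{\varepsilon^{2+\frac{\gamma\beta}{\beta-1}}}.$$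 (c) For the same $\varepsilon$, minimizers also exist when $h>0$ is optimized jointly with $N,B,\delta$ in the same regime. All of them satisfy the same relations, and $h^*\asymp h^*(\delta^*)$. (d) For the same $\varepsilon$, every feasible design, inside the regime or not, has wall-clock time at least a constant $c>0$, depending only on $\beta,\gamma,\nu$, times the right-hand side of the last relation. -/

import Mathlib

open MeasureTheory

noncomputable section

namespace AdvZOSGD

/-- Smoothing kernel of order `β` on `[-1, 1]` (only the values of `K` on `[-1, 1]` matter).
`K` is square integrable there, so that `κ = ∫ |K|²` and all the moments below are genuine. -/
structure IsSmoothingKernel (β : ℝ) (K : ℝ → ℝ) : Prop where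
  memLp : MemLp K 2 (volume.restrict (Set.Icc (-1) 1))
  integral_eq_zero : ∫ r in Set.Icc (-1 : ℝ) 1, K r = 0
  first_moment : ∫ r in Set.Icc (-1 : ℝ) 1, r * K r = 1
  absolute_moment : IntegrableOn (fun r : ℝ => |r| ^ β * |K r|) (Set.Icc (-1) 1)
  higher_moments : 2 < β → ∀ j : ℕ, 2 ≤ j → j ≤ ⌊β⌋₊ →
    ∫ r in Set.Icc (-1 : ℝ) 1, r ^ j * K r = 0

/-- The data on which the error bound depends: dimension `d`, smoothing kernel `K`, smoothness
constant `L`, initial distance `R` to the minimizer, gradient noise level `σ` at the minimizer.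
Arbitrary positive values are allowed. -/
structure Setting (β : ℝ) where
  d : ℕ
  K : ℝ → ℝ
  L : ℝ
  R : ℝ
  σ : ℝ
  d_pos : 0 < d
  kernel : IsSmoothingKernel β K
  L_pos : 0 < L
  R_pos : 0 < R
  σ_pos : 0 < σ

/-- A design: number of iterations `N`, batch size `B`, fidelity `δ`, smoothing radius `h`. -/
structure Design where
  N : ℕ
  B : ℕ
  δ : ℝ
  h : ℝ

/-- Total number `Q = B N` of gradient estimates. -/
def Design.Q (D : Design) : ℝ := (D.B : ℝ) * (D.N : ℝ)

/-- Cost of one query at fidelity `Δ`. -/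
def queryCost (γ Δ : ℝ) : ℝ := Δ ^ (-γ)

/-- Wall-clock time `B ∑ₖ c(δₖ)` of a batched method with fidelity schedule `δₖ`. -/
def wallClock (γ : ℝ) (N B : ℕ) (δ : ℕ → ℝ) : ℝ :=
  (B : ℝ) * ∑ k ∈ Finset.Icc 1 N, queryCost γ (δ k)

/-- Wall-clock time of a design, whose fidelity schedule is uniform. -/
def Design.time (γ : ℝ) (D : Design) : ℝ := wallClock γ D.N D.B (fun _ => D.δ)

namespace Setting

variable {β : ℝ} (S : Setting β)

/-- `κ = ∫ |K(u)|² du`. -/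
def κ : ℝ := ∫ u in Set.Icc (-1 : ℝ) 1, |S.K u| ^ 2

/-- `κ_β = ∫ |u|^β |K(u)| du`. -/
def κβ : ℝ := ∫ u in Set.Icc (-1 : ℝ) 1, |u| ^ β * |S.K u|

/-- First bias term `R (κ_β L h^(β-1) + d δ / h)`. -/
def biasI (δ h : ℝ) : ℝ :=
  S.R * (S.κβ * S.L * h ^ (β - 1) + S.d * δ / h)

/-- Accumulated bias term `N (κ_β² L h^(2(β-1)) + d² δ² / (L h²))`. -/
def biasII (N : ℕ) (δ h : ℝ) : ℝ :=
  N * (S.κβ ^ 2 * S.L * h ^ (2 * (β - 1)) + (S.d : ℝ) ^ 2 * δ ^ 2 / (S.L * h ^ 2))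

/-- The error bound of accelerated batched zeroth-order SGD under adversarial noise. -/
def errorBound (D : Design) : ℝ :=
  S.L * S.R ^ 2 / (D.N : ℝ) ^ 2 + S.L * S.R ^ 2 / D.Q
    + S.R / √D.Q * (√(S.d * S.κ * S.σ) + √(S.d * S.κ * S.L * D.h) + √(S.κ * (S.d * D.δ / D.h)))
    + S.biasI D.δ D.h + S.biasII D.N D.δ D.h

/-- The balancing smoothing radius `h*(δ) = (d δ / (κ_β L))^(1/β)`. -/
def hStar (δ : ℝ) : ℝ := (S.d * δ / (S.κβ * S.L)) ^ (1 / β)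

def a₁ : ℝ := (S.κβ * S.L) ^ (1 / β) * (S.d : ℝ) ^ ((β - 1) / β)

def a₂ : ℝ := S.κβ ^ (2 / β) * S.L ^ (2 / β - 1) * (S.d : ℝ) ^ (2 * (β - 1) / β)

/-- Designs meeting the accuracy constraint `errorBound ≤ ε`. -/
def feasible (ε : ℝ) : Set Design :=
  {D | 0 < D.N ∧ 0 < D.B ∧ 0 < D.δ ∧ 0 < D.h ∧ S.errorBound D ≤ ε}

/-- Large-`N`, large-`Q` regime: `N ≥ ν L R² / ε`, and `R √(κ d σ) / √Q` dominates `L R² / Q`. -/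
def largeRegime (ν ε : ℝ) : Set Design :=
  {D | ν * (S.L * S.R ^ 2 / ε) ≤ D.N ∧
    S.L * S.R ^ 2 / D.Q ≤ S.R * √(S.κ * S.d * S.σ) / √D.Q}

/-- Designs whose smoothing radius is the balancing one. -/
def balanced : Set Design := {D | D.h = S.hStar D.δ}

/-- The order of the optimal fidelity. -/
def fidelityOrder (ε : ℝ) : ℝ :=
  ε ^ (β / (β - 1)) /
    (S.d * S.κβ ^ (1 / (β - 1)) * S.L ^ (1 / (β - 1)) * S.R ^ (β / (β - 1)))

/-- The order of the optimal wall-clock time. -/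
def timeOrder (γ ε : ℝ) : ℝ :=
  S.κ * S.σ * (S.d : ℝ) ^ (1 + γ) * S.κβ ^ (γ / (β - 1)) * S.L ^ (γ / (β - 1))
      * S.R ^ (2 + γ * β / (β - 1))
    / ε ^ (2 + γ * β / (β - 1))

end Setting

/-- `D` attains the minimum of the wall-clock time over `F`. -/
def IsOptimal (γ : ℝ) (F : Set Design) (D : Design) : Prop :=
  D ∈ F ∧ IsMinOn (Design.time γ) F D

/-- `x ≍ y` with explicit constants: `c y ≤ x ≤ C y`. -/
def Comparable (c C x y : ℝ) : Prop := c * y ≤ x ∧ x ≤ C * y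

/-- The claimed orders of `N`, `Q`, `B`, `δ`, `h` and of the wall-clock time. -/
structure HasClaimedOrders {β : ℝ} (S : Setting β) (γ c C ε : ℝ) (D : Design) : Prop where
  N_order : Comparable c C D.N (S.L * S.R ^ 2 / ε)
  Q_order : Comparable c C D.Q (S.R ^ 2 * S.κ * S.d * S.σ / ε ^ 2)
  B_order : Comparable c C D.B (S.κ * S.d * S.σ / (S.L * ε))
  δ_order : Comparable c C D.δ (S.fidelityOrder ε)
  h_order : Comparable c C D.h (S.hStar D.δ)
  time_order : Comparable c C (D.time γ) (S.timeOrder γ ε)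

end AdvZOSGD

end

/-!
Write `u(δ) = a₁ δ^p` with `p = (β - 1) / β` (`biasLevel`). The two parts `κ_β L h^(β-1)` and
`d δ / h` of the bias are respectively increasing and decreasing in `h`, and both equal `u(δ)` at
`h = h*(δ)`. Hence, for every radius `h`, the first bias term is at least `R u(δ)` and the
accumulated one at least `N u(δ)² / L`, with equality up to a factor `2` at `h*(δ)`.

*Lower bound.* The fidelity `Φ = fidelityOrder ε` is the one with `R u(Φ) = ε`. Feasibility
therefore forces `δ ≤ Φ`, and the gradient noise term forces `Q ≥ Q₀ := R² κ d σ / ε²`. Since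
`timeOrder = Q₀ Φ^(-γ)`, every feasible design takes at least that time
(`timeOrder_le_of_feasible`).

*Upper bound.* Taking `N` of order `L R² / ε`, `B` of order `κ d σ / (L ε)`, `δ` a small constant
times `Φ` and `h = h*(δ)` gives a feasible design of the regime whose time is at most a constant
`M` times `timeOrder`, once `ε` is small (`exists_feasible_time_le`).

*Orders of the minimizers.* If the time is at most `M Q₀ Φ^(-γ)`, then `Q ≥ Q₀` and `δ ≤ Φ` are
both tight up to constants. So `u(δ)` is of order `ε / R`; the accumulated bias then bounds `N` by
a multiple of `L R² / ε`, matching the lower bound built into the regime, `B` is `Q / N`, and each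
part of the first bias term bounds `h` on one side by a multiple of `h*(δ)`
(`hasClaimedOrders_of_time_le`). This argument does not see whether `h` was fixed or optimized.

*Existence.* The designs of bounded time in the feasible set lie in a compact box away from the
singularities of the error bound, on which error bound and time are continuous
(`exists_isOptimal`).
-/

namespace AdvZOSGD

theorem Design.time_eq (γ : ℝ) (D : Design) : D.time γ = D.Q * D.δ ^ (-γ) := by
  simp [Design.time, wallClock, queryCost, Design.Q, mul_assoc]

/-- The design with the given coordinates; `ℕ × ℕ × ℝ × ℝ` carries the topology used for
compactness. -/
def Design.ofProd (x : ℕ × ℕ × ℝ × ℝ) : Design := ⟨x.1, x.2.1, x.2.2.1, x.2.2.2⟩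

/-! ### Positivity of the kernel constants -/

theorem IsSmoothingKernel.not_ae_eq_zero {β : ℝ} {K : ℝ → ℝ} (hK : IsSmoothingKernel β K) :
    ¬ K =ᵐ[volume.restrict (Set.Icc (-1) 1)] 0 := by
  intro h
  have h1 : ∫ r in Set.Icc (-1 : ℝ) 1, r * K r = 0 :=
    integral_eq_zero_of_ae (h.mono fun r hr => by simp [hr])
  exact zero_ne_one (h1.symm.trans hK.first_moment)

namespace Setting

variable {β : ℝ} (S : Setting β)

theorem κ_pos : 0 < S.κ := by
  refine lt_of_le_of_ne (integral_nonneg fun u => by positivity) fun h => ?_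
  have hint : Integrable (fun u => |S.K u| ^ 2) (volume.restrict (Set.Icc (-1 : ℝ) 1)) := by
    simpa [sq_abs] using S.kernel.memLp.integrable_sq
  have h0 := (integral_eq_zero_iff_of_nonneg (fun u => by positivity) hint).1 h.symm
  exact S.kernel.not_ae_eq_zero (h0.mono fun u hu => by simpa using hu)

theorem κβ_pos : 0 < S.κβ := by
  refine lt_of_le_of_ne (integral_nonneg fun u => by positivity) fun h => ?_
  have h0 := (integral_eq_zero_iff_of_nonneg (fun u => by positivity)
    S.kernel.absolute_moment).1 h.symm
  refine S.kernel.not_ae_eq_zero ?_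
  filter_upwards [h0, Measure.ae_ne (volume.restrict (Set.Icc (-1 : ℝ) 1)) 0] with u hu hu0
  have hne : |u| ^ β ≠ 0 := (Real.rpow_pos_of_pos (abs_pos.2 hu0) β).ne'
  simpa [hne] using hu

theorem cast_d_pos : (0 : ℝ) < S.d := Nat.cast_pos.2 S.d_pos

/-! ### The balanced radius and the bias level -/

/-- The common value of the two parts `κ_β L h^(β-1)` and `d δ / h` of the bias at the balancing
radius `h = h*(δ)`. Up to a factor `2` it is the smallest bias that fidelity `δ` permits. -/
noncomputable def biasLevel (δ : ℝ) : ℝ := S.a₁ * δ ^ ((β - 1) / β)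

theorem a₁_pos : 0 < S.a₁ := by
  have := S.κβ_pos; have := S.L_pos; have := S.cast_d_pos
  unfold a₁; positivity

theorem biasLevel_pos {δ : ℝ} (hδ : 0 < δ) : 0 < S.biasLevel δ :=
  mul_pos S.a₁_pos (Real.rpow_pos_of_pos hδ _)

theorem biasLevel_mul {t δ : ℝ} (ht : 0 ≤ t) (hδ : 0 ≤ δ) :
    S.biasLevel (t * δ) = t ^ ((β - 1) / β) * S.biasLevel δ := by
  unfold biasLevel; rw [Real.mul_rpow ht hδ]; ring

theorem biasLevel_le_biasLevel_iff (hβ : 1 < β) {δ δ' : ℝ} (hδ : 0 ≤ δ) (hδ' : 0 ≤ δ') :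
    S.biasLevel δ ≤ S.biasLevel δ' ↔ δ ≤ δ' := by
  have hp : 0 < (β - 1) / β := div_pos (by linarith) (by linarith)
  rw [biasLevel, biasLevel, mul_le_mul_iff_right₀ S.a₁_pos, Real.rpow_le_rpow_iff hδ hδ' hp]

theorem hStar_pos {δ : ℝ} (hδ : 0 < δ) : 0 < S.hStar δ := by
  have := S.κβ_pos; have := S.L_pos; have := S.cast_d_pos
  unfold hStar; positivity

theorem noise_part_hStar (hβ : 0 < β) {δ : ℝ} (hδ : 0 < δ) :
    S.d * δ / S.hStar δ = S.biasLevel δ := by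
  have h1 := S.κβ_pos; have h2 := S.L_pos; have h3 := S.cast_d_pos
  have hd : (0 : ℝ) < S.d * δ := by positivity
  have e : (β - 1) / β = 1 - 1 / β := by field_simp
  unfold hStar biasLevel a₁
  rw [Real.div_rpow hd.le (by positivity), e, mul_assoc, ← Real.mul_rpow h3.le hδ.le,
    Real.rpow_sub hd, Real.rpow_one]
  field_simp

theorem smoothing_part_hStar (hβ : 0 < β) {δ : ℝ} (hδ : 0 < δ) :
    S.κβ * S.L * S.hStar δ ^ (β - 1) = S.biasLevel δ := by
  have h1 := S.κβ_pos; have h2 := S.L_pos; have h3 := S.cast_d_pos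
  have e : S.hStar δ ^ β = S.d * δ / (S.κβ * S.L) := by
    unfold hStar
    rw [← Real.rpow_mul (by positivity), one_div_mul_cancel hβ.ne', Real.rpow_one]
  rw [← S.noise_part_hStar hβ hδ, Real.rpow_sub (S.hStar_pos hδ), Real.rpow_one, e]
  field_simp

theorem a₂_mul_rpow {δ : ℝ} (hδ : 0 < δ) :
    S.a₂ * δ ^ (2 * ((β - 1) / β)) = S.biasLevel δ ^ 2 / S.L := by
  have h1 := S.κβ_pos; have h2 := S.L_pos; have h3 := S.cast_d_pos
  unfold a₂ biasLevel a₁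
  have sq : ∀ x y : ℝ, 0 < x → x ^ (2 * y) = (x ^ y) ^ 2 := fun x y hx => by
    rw [mul_comm, Real.rpow_mul hx.le]; norm_num
  rw [sq _ _ hδ, mul_div_assoc, sq _ _ h3, show 2 / β = 2 * (1 / β) by ring, sq _ _ h1,
    Real.rpow_sub h2, Real.rpow_one, sq _ _ h2, Real.mul_rpow h1.le h2.le]
  ring

/-- The accumulated bias is `N / L` times the sum of squares of the two parts of the first bias
term. -/
theorem biasII_eq (N : ℕ) (δ : ℝ) {h : ℝ} (hh : 0 < h) :
    S.biasII N δ h =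
      N * (((S.κβ * S.L * h ^ (β - 1)) ^ 2 + (S.d * δ / h) ^ 2) / S.L) := by
  have h2 := S.L_pos
  unfold biasII
  rw [mul_comm 2 (β - 1), Real.rpow_mul hh.le, show ((2 : ℝ)) = ((2 : ℕ) : ℝ) by norm_num,
    Real.rpow_natCast]
  field_simp

theorem biasI_hStar (hβ : 0 < β) {δ : ℝ} (hδ : 0 < δ) :
    S.biasI δ (S.hStar δ) = 2 * S.R * S.biasLevel δ := by
  unfold biasI
  rw [S.smoothing_part_hStar hβ hδ, S.noise_part_hStar hβ hδ]; ring

theorem biasII_hStar (hβ : 0 < β) (N : ℕ) {δ : ℝ} (hδ : 0 < δ) :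
    S.biasII N δ (S.hStar δ) = 2 * N * (S.biasLevel δ ^ 2 / S.L) := by
  rw [S.biasII_eq N δ (S.hStar_pos hδ), S.smoothing_part_hStar hβ hδ,
    S.noise_part_hStar hβ hδ]; ring

/-- One of the two parts of the bias is at least the bias level: the first one increases and the
second one decreases in `h`, and they cross at `h*(δ)`. -/
theorem biasLevel_le_or (hβ : 1 < β) {δ h : ℝ} (hδ : 0 < δ) (hh : 0 < h) :
    S.biasLevel δ ≤ S.κβ * S.L * h ^ (β - 1) ∨ S.biasLevel δ ≤ S.d * δ / h := by
  have h1 := S.κβ_pos; have h2 := S.L_pos; have h3 := S.cast_d_pos; have h4 := S.hStar_pos hδ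
  rcases le_total (S.hStar δ) h with h' | h'
  · left
    rw [← S.smoothing_part_hStar (by linarith) hδ]
    gcongr
  · right
    rw [← S.noise_part_hStar (by linarith) hδ]
    gcongr

theorem mul_biasLevel_le_biasI (hβ : 1 < β) {δ h : ℝ} (hδ : 0 < δ) (hh : 0 < h) :
    S.R * S.biasLevel δ ≤ S.biasI δ h := by
  have h1 := S.κβ_pos; have h2 := S.L_pos; have h3 := S.cast_d_pos
  have h5 : 0 < S.κβ * S.L * h ^ (β - 1) := by positivity
  have h6 : 0 < S.d * δ / h := by positivity
  refine mul_le_mul_of_nonneg_left ?_ S.R_pos.le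
  rcases S.biasLevel_le_or hβ hδ hh with h' | h' <;> linarith

theorem mul_biasLevel_sq_le_biasII (hβ : 1 < β) (N : ℕ) {δ h : ℝ} (hδ : 0 < δ) (hh : 0 < h) :
    N * (S.biasLevel δ ^ 2 / S.L) ≤ S.biasII N δ h := by
  have h2 := S.L_pos; have h0 := (S.biasLevel_pos hδ).le
  rw [S.biasII_eq N δ hh]
  gcongr
  rcases S.biasLevel_le_or hβ hδ hh with h' | h'
  · have := pow_le_pow_left₀ h0 h' 2
    nlinarith [sq_nonneg (S.d * δ / h)]
  · have := pow_le_pow_left₀ h0 h' 2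
    nlinarith [sq_nonneg (S.κβ * S.L * h ^ (β - 1))]

/-! ### The claimed orders -/

theorem fidelityOrder_pos {ε : ℝ} (hε : 0 < ε) : 0 < S.fidelityOrder ε := by
  have := S.κβ_pos; have := S.L_pos; have := S.cast_d_pos; have := S.R_pos
  unfold fidelityOrder; positivity

/-- The order of the optimal fidelity is the one at which the first bias term meets the target. -/
theorem biasLevel_fidelityOrder (hβ : 1 < β) {ε : ℝ} (hε : 0 < ε) :
    S.biasLevel (S.fidelityOrder ε) = ε / S.R := by
  have h1 := S.κβ_pos; have h2 := S.L_pos; have h3 := S.cast_d_pos; have h4 := S.R_pos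
  have hb : β - 1 ≠ 0 := by linarith
  have hb' : β ≠ 0 := by linarith
  have e1 : β / (β - 1) * ((β - 1) / β) = 1 := by field_simp
  have e2 : 1 / (β - 1) * ((β - 1) / β) = 1 / β := by field_simp
  unfold biasLevel a₁ fidelityOrder
  rw [Real.div_rpow (by positivity) (by positivity), Real.mul_rpow (by positivity) (by positivity),
    Real.mul_rpow (by positivity) (by positivity), Real.mul_rpow (by positivity) (by positivity),
    Real.mul_rpow (by positivity) (by positivity), ← Real.rpow_mul hε.le,
    ← Real.rpow_mul h1.le, ← Real.rpow_mul h2.le, ← Real.rpow_mul h4.le, e1, e2, Real.rpow_one, Real.rpow_one]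
  field_simp

theorem timeOrder_eq (γ : ℝ) {ε : ℝ} (hε : 0 < ε) :
    S.timeOrder γ ε =
      S.R ^ 2 * S.κ * S.d * S.σ / ε ^ 2 * S.fidelityOrder ε ^ (-γ) := by
  have h1 := S.κβ_pos; have h2 := S.L_pos; have h3 := S.cast_d_pos; have h4 := S.R_pos
  have sq : ∀ x : ℝ, 0 < x → x ^ (2 + γ * β / (β - 1)) = x ^ 2 * x ^ (β / (β - 1) * γ) :=
    fun x hx => by
      rw [Real.rpow_add hx, show γ * β / (β - 1) = β / (β - 1) * γ by ring]; norm_num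
  unfold timeOrder fidelityOrder
  rw [Real.rpow_neg (by positivity), Real.div_rpow (by positivity) (by positivity),
    Real.mul_rpow (by positivity) (by positivity), Real.mul_rpow (by positivity) (by positivity),
    Real.mul_rpow (by positivity) (by positivity),
    ← Real.rpow_mul hε.le, ← Real.rpow_mul h1.le, ← Real.rpow_mul h2.le, ← Real.rpow_mul h4.le,
    sq _ hε, sq _ h4, Real.rpow_add h3, Real.rpow_one,
    show 1 / (β - 1) * γ = γ / (β - 1) by ring]
  field_simp

theorem timeOrder_pos (γ : ℝ) {ε : ℝ} (hε : 0 < ε) : 0 < S.timeOrder γ ε := by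
  have := S.κβ_pos; have := S.L_pos; have := S.cast_d_pos; have := S.R_pos; have := S.κ_pos
  have := S.σ_pos
  unfold timeOrder; positivity

/-! ### Consequences of feasibility -/

/-- All the terms of the error bound are nonnegative, so each of those used below is at most `ε`
in a feasible design. -/
theorem terms_le_of_feasible {ε : ℝ} {D : Design} (hD : D ∈ S.feasible ε) :
    S.R / √D.Q * √(S.d * S.κ * S.σ) ≤ ε ∧ S.biasI D.δ D.h ≤ ε ∧ S.biasII D.N D.δ D.h ≤ ε := by
  obtain ⟨hN, hB, hδ, hh, hE⟩ := hD
  have h1 := S.κβ_pos; have h2 := S.L_pos; have h3 := S.cast_d_pos; have h4 := S.R_pos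
  have hQ : 0 < D.Q := by unfold Design.Q; positivity
  have hN' : (0 : ℝ) < D.N := by positivity
  have t1 : 0 ≤ S.L * S.R ^ 2 / (D.N : ℝ) ^ 2 := by positivity
  have t2 : 0 ≤ S.L * S.R ^ 2 / D.Q := by positivity
  have t3 : 0 ≤ S.R / √D.Q * √(S.d * S.κ * S.σ) := by positivity
  have t4 : 0 ≤ S.R / √D.Q * √(S.d * S.κ * S.L * D.h) := by positivity
  have t5 : 0 ≤ S.R / √D.Q * √(S.κ * (S.d * D.δ / D.h)) := by positivity
  have t6 : 0 ≤ S.biasI D.δ D.h := by unfold biasI; positivity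
  have t7 : 0 ≤ S.biasII D.N D.δ D.h := by unfold biasII; positivity
  unfold errorBound at hE
  rw [mul_add, mul_add] at hE
  refine ⟨?_, ?_, ?_⟩ <;> linarith

theorem Q_ge_of_feasible {ε : ℝ} (hε : 0 < ε) {D : Design} (hD : D ∈ S.feasible ε) :
    S.R ^ 2 * S.κ * S.d * S.σ / ε ^ 2 ≤ D.Q := by
  have h := (S.terms_le_of_feasible hD).1
  obtain ⟨hN, hB, -⟩ := hD
  have hk := S.κ_pos; have h3 := S.cast_d_pos; have h4 := S.R_pos; have h5 := S.σ_pos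
  have hQ : 0 < D.Q := by unfold Design.Q; positivity
  have h' := pow_le_pow_left₀ (by positivity) h 2
  rw [mul_pow, div_pow, Real.sq_sqrt hQ.le, Real.sq_sqrt (by positivity), div_mul_eq_mul_div,
    div_le_iff₀ hQ] at h'
  rw [div_le_iff₀ (by positivity)]
  linarith

theorem δ_le_of_feasible (hβ : 1 < β) {ε : ℝ} (hε : 0 < ε) {D : Design} (hD : D ∈ S.feasible ε) :
    D.δ ≤ S.fidelityOrder ε := by
  have h := (S.terms_le_of_feasible hD).2.1
  obtain ⟨-, -, hδ, hh, -⟩ := hD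
  rw [← S.biasLevel_le_biasLevel_iff hβ hδ.le (S.fidelityOrder_pos hε).le,
    S.biasLevel_fidelityOrder hβ hε, le_div_iff₀' S.R_pos]
  exact (S.mul_biasLevel_le_biasI hβ hδ hh).trans h

theorem timeOrder_le_of_feasible {γ : ℝ} (hβ : 1 < β) (hγ : 0 < γ) {ε : ℝ} (hε : 0 < ε)
    {D : Design} (hD : D ∈ S.feasible ε) : S.timeOrder γ ε ≤ D.time γ := by
  have hk := S.κ_pos; have h3 := S.cast_d_pos; have h4 := S.R_pos; have h5 := S.σ_pos
  have hQ := S.Q_ge_of_feasible hε hD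
  rw [D.time_eq, S.timeOrder_eq γ hε]
  have := Real.rpow_le_rpow_of_nonpos hD.2.2.1 (S.δ_le_of_feasible hβ hε hD) (neg_nonpos.2 hγ.le)
  have := S.fidelityOrder_pos hε
  exact mul_le_mul hQ ‹_› (by positivity) (le_trans (by positivity) hQ)

/-- A feasible design of the regime whose time is at most `M` times the claimed order has all
the claimed orders. The number `m` is the fraction of `fidelityOrder` that the time budget
enforces: it keeps the bias level above `m ^ p * ε / R`, and then the accumulated bias bounds `N`
from above and the two parts of the first bias term confine `h`. -/
theorem hasClaimedOrders_of_time_le {γ ν M m c C : ℝ} (hβ : 1 < β) (hγ : 0 < γ) (hν : 0 < ν)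
    (hM : 0 < M) (hm : m = M ^ (-(1 / γ)))
    (hc : c ≤ 1 ∧ c ≤ ν ∧ c ≤ m ∧ c ≤ (m ^ ((β - 1) / β)) ^ 2 ∧ c ≤ m ^ ((β - 1) / β))
    (hC : 1 ≤ C ∧ M ≤ C ∧ ((m ^ ((β - 1) / β)) ^ 2)⁻¹ ≤ C ∧ M / ν ≤ C ∧ m ^ (-(1 / β)) ≤ C)
    {ε : ℝ} (hε : 0 < ε) {D : Design} (hD : D ∈ S.feasible ε) (hD' : D ∈ S.largeRegime ν ε)
    (hT : D.time γ ≤ M * S.timeOrder γ ε) : HasClaimedOrders S γ c C ε D := by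
  have h1 := S.κβ_pos; have h2 := S.L_pos; have h3 := S.cast_d_pos; have h4 := S.R_pos
  have hk := S.κ_pos; have h5 := S.σ_pos
  obtain ⟨c1, c2, c3, c4, c5⟩ := hc
  obtain ⟨C1, C2, C3, C4, C5⟩ := hC
  have hΦ := S.fidelityOrder_pos hε
  have hTlow := S.timeOrder_le_of_feasible hβ hγ hε hD
  have hQlow := S.Q_ge_of_feasible hε hD
  have hδup := S.δ_le_of_feasible hβ hε hD
  have ⟨_, hI, hII⟩ := S.terms_le_of_feasible hD
  have hNlow := hD'.1
  obtain ⟨hN, hB, hδ, hh, -⟩ := hD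
  have hN' : (0 : ℝ) < D.N := by positivity
  have hB' : (0 : ℝ) < D.B := by positivity
  have hQ : 0 < D.Q := by unfold Design.Q; positivity
  have hm0 : 0 < m := by rw [hm]; positivity
  set Qo := S.R ^ 2 * S.κ * S.d * S.σ / ε ^ 2 with hQo
  set X := S.L * S.R ^ 2 / ε with hX
  set Y := S.κ * S.d * S.σ / (S.L * ε) with hY
  have hQo0 : 0 < Qo := by positivity
  have hX0 : 0 < X := by positivity
  have hY0 : 0 < Y := by positivity
  have hXY : Qo = X * Y := by rw [hQo, hX, hY]; field_simp
  have hTeq := D.time_eq γ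
  have hToeq := S.timeOrder_eq γ hε
  have hδΦ := Real.rpow_le_rpow_of_nonpos hδ hδup (neg_nonpos.2 hγ.le)
  have hΦγ : 0 < S.fidelityOrder ε ^ (-γ) := by positivity
  have hδγ : 0 < D.δ ^ (-γ) := by positivity
  -- since `T = Q δ^(-γ)` with `Q ≥ Q₀` and `δ ≤ Φ`, the time budget bounds each factor separately
  have hQup : D.Q ≤ M * Qo := by
    refine le_of_mul_le_mul_right ?_ hΦγ
    calc D.Q * S.fidelityOrder ε ^ (-γ) ≤ D.Q * D.δ ^ (-γ) := by gcongr
      _ ≤ M * Qo * S.fidelityOrder ε ^ (-γ) := by rw [← hTeq, mul_assoc, ← hToeq]; exact hT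
  have hδlow : m * S.fidelityOrder ε ≤ D.δ := by
    rw [← Real.rpow_le_rpow_iff_of_neg hδ (by positivity) (neg_lt_zero.2 hγ),
      Real.mul_rpow hm0.le hΦ.le, hm, ← Real.rpow_mul hM.le,
      show -(1 / γ) * -γ = 1 by field_simp, Real.rpow_one]
    refine le_of_mul_le_mul_left ?_ hQo0
    calc Qo * D.δ ^ (-γ) ≤ D.Q * D.δ ^ (-γ) := by gcongr
      _ ≤ Qo * (M * S.fidelityOrder ε ^ (-γ)) := by
        rw [← hTeq]; refine hT.trans_eq ?_; rw [hToeq]; ring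
  set mp := m ^ ((β - 1) / β) with hmp
  have hmp0 : 0 < mp := by positivity
  have hu : mp * (ε / S.R) ≤ S.biasLevel D.δ := by
    rw [← S.biasLevel_fidelityOrder hβ hε, ← S.biasLevel_mul hm0.le hΦ.le,
      S.biasLevel_le_biasLevel_iff hβ (by positivity) hδ.le]
    exact hδlow
  have hu0 := S.biasLevel_pos hδ
  have hNup : D.N ≤ (mp ^ 2)⁻¹ * X := by
    have hle : (D.N : ℝ) * ((mp * (ε / S.R)) ^ 2 / S.L) ≤ ε := by
      refine le_trans ?_ ((S.mul_biasLevel_sq_le_biasII hβ D.N hδ hh).trans hII)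
      gcongr
    rw [← le_div_iff₀ (by positivity)] at hle
    refine hle.trans_eq ?_
    rw [hX]; field_simp
  have hQBN : D.Q = D.B * D.N := rfl
  have hs : 0 < S.hStar D.δ := S.hStar_pos hδ
  have hv0 : 0 < S.d * D.δ / D.h := by positivity
  have hs0 : 0 < S.κβ * S.L * D.h ^ (β - 1) := by positivity
  -- each part of the first bias term is at most `ε / R`, hence at most a multiple of `u(δ)`
  have hεR : ε ≤ S.R * (mp⁻¹ * S.biasLevel D.δ) := by
    have h6 : ε / S.R ≤ mp⁻¹ * S.biasLevel D.δ := by rwa [le_inv_mul_iff₀ hmp0]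
    rwa [div_le_iff₀' h4] at h6
  have hI' := le_of_mul_le_mul_left (hI.trans hεR) h4
  refine ⟨⟨?_, ?_⟩, ⟨?_, ?_⟩, ⟨?_, ?_⟩, ⟨?_, ?_⟩, ⟨?_, ?_⟩, ⟨?_, ?_⟩⟩
  · exact le_trans (by gcongr) hNlow
  · exact hNup.trans (by gcongr)
  · exact le_trans (mul_le_of_le_one_left hQo0.le c1) hQlow
  · exact hQup.trans (by gcongr)
  · refine (mul_le_mul_of_nonneg_right c4 hY0.le).trans ?_
    refine le_of_mul_le_mul_right ?_ hX0
    calc mp ^ 2 * Y * X = mp ^ 2 * Qo := by rw [hXY]; ring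
      _ ≤ mp ^ 2 * (D.B * D.N) := by rw [← hQBN]; gcongr
      _ ≤ mp ^ 2 * (D.B * ((mp ^ 2)⁻¹ * X)) := by gcongr
      _ = D.B * X := by field_simp
  · refine le_trans ?_ (mul_le_mul_of_nonneg_right C4 hY0.le)
    refine le_of_mul_le_mul_right ?_ (mul_pos hν hX0)
    calc D.B * (ν * X) ≤ D.B * D.N := by gcongr
      _ ≤ M * (X * Y) := by rw [← hQBN, ← hXY]; exact hQup
      _ = M / ν * Y * (ν * X) := by field_simp
  · exact le_trans (by gcongr) hδlow
  · exact hδup.trans (le_mul_of_one_le_left hΦ.le C1)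
  · refine (mul_le_mul_of_nonneg_right c5 hs.le).trans ?_
    have h7 : S.d * D.δ / D.h ≤ mp⁻¹ * (S.d * D.δ / S.hStar D.δ) := by
      rw [S.noise_part_hStar (by linarith) hδ]; linarith
    rw [div_le_iff₀ hh] at h7
    have h8 : S.d * D.δ * (mp * S.hStar D.δ) ≤ S.d * D.δ * D.h := by
      calc _ ≤ mp⁻¹ * (S.d * D.δ / S.hStar D.δ) * D.h * (mp * S.hStar D.δ) := by gcongr
        _ = _ := by field_simp
    exact le_of_mul_le_mul_left h8 (by positivity)
  · refine le_trans ?_ (mul_le_mul_of_nonneg_right C5 hs.le)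
    have h7 : S.κβ * S.L * D.h ^ (β - 1) ≤
        mp⁻¹ * (S.κβ * S.L * S.hStar D.δ ^ (β - 1)) := by
      rw [S.smoothing_part_hStar (by linarith) hδ]; linarith
    have h8 : D.h ^ (β - 1) ≤ mp⁻¹ * S.hStar D.δ ^ (β - 1) :=
      le_of_mul_le_mul_left (h7.trans_eq (by ring)) (mul_pos h1 h2)
    rw [← Real.rpow_le_rpow_iff hh.le (by positivity) (show 0 < β - 1 by linarith),
      Real.mul_rpow (by positivity) hs.le, ← Real.rpow_mul hm0.le]
    refine h8.trans_eq ?_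
    rw [hmp, ← Real.rpow_neg hm0.le]
    congr 2; ring
  · exact le_trans (mul_le_of_le_one_left (S.timeOrder_pos γ hε).le c1) hTlow
  · have := S.timeOrder_pos γ hε
    exact hT.trans (by gcongr)

/-! ### A feasible design of the claimed order -/

/-- In the large-`Q` regime, with a radius at which the noise part of the bias is at most `d σ`
and `h ≤ σ / L`, the term `L R² / Q` and the three stochastic terms of the error
bound are together at most four times `R √(d κ σ) / √Q`. -/
theorem errorBound_le {D : Design} (hQ : 0 < D.Q) (hh : D.h ≤ S.σ / S.L)
    (hδ : S.d * D.δ / D.h ≤ S.d * S.σ)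
    (hreg : S.L * S.R ^ 2 / D.Q ≤ S.R * √(S.κ * S.d * S.σ) / √D.Q) :
    S.errorBound D ≤ S.L * S.R ^ 2 / (D.N : ℝ) ^ 2
      + 4 * (S.R / √D.Q * √(S.d * S.κ * S.σ)) + S.biasI D.δ D.h + S.biasII D.N D.δ D.h := by
  have h2 := S.L_pos; have h3 := S.cast_d_pos; have h4 := S.R_pos
  have hk := S.κ_pos; have h5 := S.σ_pos
  have r1 : √(S.d * S.κ * S.L * D.h) ≤ √(S.d * S.κ * S.σ) := by
    apply Real.sqrt_le_sqrt
    rw [le_div_iff₀' h2] at hh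
    rw [mul_assoc _ S.L]
    gcongr
  have r2 : √(S.κ * (S.d * D.δ / D.h)) ≤ √(S.d * S.κ * S.σ) := by
    apply Real.sqrt_le_sqrt
    calc S.κ * (S.d * D.δ / D.h) ≤ S.κ * (S.d * S.σ) := by gcongr
      _ = S.d * S.κ * S.σ := by ring
  have e : S.R * √(S.κ * S.d * S.σ) / √D.Q = S.R / √D.Q * √(S.d * S.κ * S.σ) := by
    rw [mul_comm S.κ]; ring
  rw [e] at hreg
  have hRQ : 0 ≤ S.R / √D.Q := by positivity
  have r1' := mul_le_mul_of_nonneg_left r1 hRQ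
  have r2' := mul_le_mul_of_nonneg_left r2 hRQ
  unfold errorBound
  rw [mul_add, mul_add]
  linarith

/-- The threshold for the target accuracy. Below it the two stochastic terms that depend on `h`
and `δ` are dominated by the gradient noise, and rounding `N` and `B` to integers costs only
constants. -/
noncomputable def accuracyThreshold : ℝ :=
  min (min (S.L * S.R ^ 2 / 8) (S.κ * S.d * S.σ / S.L))
    (min (S.R * (S.d * S.σ)) (S.R * (S.κβ * S.L * (S.σ / S.L) ^ (β - 1))))

theorem accuracyThreshold_pos : 0 < S.accuracyThreshold := by
  have h1 := S.κβ_pos; have h2 := S.L_pos; have h3 := S.cast_d_pos; have h4 := S.R_pos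
  have hk := S.κ_pos; have h5 := S.σ_pos
  refine lt_min (lt_min ?_ ?_) (lt_min ?_ ?_) <;> positivity

/-- A design of the claimed order, with the balanced radius: `N` and `B` are rounded up from
multiples of `L R² / ε` and `κ d σ / (L ε)`, and the fidelity is a constant fraction of
`fidelityOrder`. -/
theorem exists_feasible_time_le {γ ν A : ℝ} (hβ : 1 < β) (hν : 0 < ν) (hA : A = ν + 1)
    {ε : ℝ} (hε : 0 < ε) (hε₀ : ε ≤ S.accuracyThreshold) :
    ∃ D ∈ S.feasible ε ∩ S.largeRegime ν ε ∩ S.balanced,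
      D.time γ ≤ 257 * (A + 1) * ((1 / (16 * (A + 1))) ^ (β / (β - 1))) ^ (-γ)
        * S.timeOrder γ ε := by
  have h1 := S.κβ_pos; have h2 := S.L_pos; have h3 := S.cast_d_pos; have h4 := S.R_pos
  have hk := S.κ_pos; have h5 := S.σ_pos
  have hA1 : 1 ≤ A := by linarith
  obtain ⟨⟨l1, l2⟩, l3, l4⟩ : (ε ≤ S.L * S.R ^ 2 / 8 ∧ ε ≤ S.κ * S.d * S.σ / S.L) ∧
      ε ≤ S.R * (S.d * S.σ) ∧ ε ≤ S.R * (S.κβ * S.L * (S.σ / S.L) ^ (β - 1)) := by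
    simpa only [accuracyThreshold, le_min_iff] using hε₀
  -- `s` is the ratio of `u(δ)` to `ε / R`; it makes each of the two bias terms at most `ε / 8`,
  -- the accumulated one because `N ≤ (A + 1) L R² / ε`
  set s := 1 / (16 * (A + 1)) with hs
  have hs0 : 0 < s := by positivity
  have hs1 : s ≤ 1 := by rw [hs, div_le_one (by positivity)]; linarith
  set τ := s ^ (β / (β - 1)) with hτ
  have hτ0 : 0 < τ := by positivity
  have hτp : τ ^ ((β - 1) / β) = s := by
    have hb : β - 1 ≠ 0 := by linarith
    have hb' : β ≠ 0 := by linarith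
    rw [hτ, ← Real.rpow_mul hs0.le, show β / (β - 1) * ((β - 1) / β) = 1 by field_simp,
      Real.rpow_one]
  have hΦ := S.fidelityOrder_pos hε
  set X := S.L * S.R ^ 2 / ε with hX
  set Y := S.κ * S.d * S.σ / (S.L * ε) with hY
  set Qo := S.R ^ 2 * S.κ * S.d * S.σ / ε ^ 2 with hQo
  have hXY : Qo = X * Y := by rw [hQo, hX, hY]; field_simp
  have hX8 : 8 ≤ X := by rw [hX, le_div_iff₀ hε]; linarith
  have hY1 : 1 ≤ Y := by
    rw [hY, le_div_iff₀ (by positivity)]; rw [le_div_iff₀ h2] at l2; linarith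
  set N := ⌈A * X⌉₊ with hN
  set B := ⌈256 * Y⌉₊ with hB
  have hNl : A * X ≤ N := Nat.le_ceil _
  have hNu : N ≤ (A + 1) * X := by
    have := (Nat.ceil_lt_add_one (by positivity : 0 ≤ A * X)).le
    linarith
  have hBl : 256 * Y ≤ B := Nat.le_ceil _
  have hBu : B ≤ 257 * Y := by
    have := (Nat.ceil_lt_add_one (by positivity : 0 ≤ 256 * Y)).le
    linarith
  have hXN : X ≤ N := le_trans (le_mul_of_one_le_left (by positivity) hA1) hNl
  have hN0 : (0 : ℝ) < N := by linarith
  have hB0 : (0 : ℝ) < B := by linarith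
  set δ := τ * S.fidelityOrder ε with hδ
  have hδ0 : 0 < δ := by positivity
  have hh0 := S.hStar_pos hδ0
  have hu : S.biasLevel δ = s * (ε / S.R) := by
    rw [hδ, S.biasLevel_mul hτ0.le hΦ.le, hτp, S.biasLevel_fidelityOrder hβ hε]
  have hule : S.biasLevel δ ≤ ε / S.R := by
    rw [hu]; exact mul_le_of_le_one_left (by positivity) hs1
  let D : Design := ⟨N, B, δ, S.hStar δ⟩
  have hQdef : D.Q = B * N := rfl
  have hQ256 : 256 * Qo ≤ D.Q := by
    rw [hXY, hQdef]
    calc 256 * (X * Y) = 256 * Y * X := by ring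
      _ ≤ B * N := by gcongr
  have hQ : 0 < D.Q := by rw [hQdef]; positivity
  have hQo0 : 0 < Qo := by positivity
  -- `√Q` exceeds `16 R √(d κ σ) / ε`
  have hnoise : S.R * √(S.d * S.κ * S.σ) / ε * 16 ≤ √D.Q := by
    apply Real.le_sqrt_of_sq_le
    refine le_trans (le_of_eq ?_) hQ256
    rw [mul_pow, div_pow, mul_pow, Real.sq_sqrt (by positivity), hQo]
    ring
  have hsqQ : 0 < √D.Q := Real.sqrt_pos.2 hQ
  have hreg : S.L * S.R ^ 2 / D.Q ≤ S.R * √(S.κ * S.d * S.σ) / √D.Q := by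
    have e : √(S.κ * S.d * S.σ) = √(S.d * S.κ * S.σ) := by rw [mul_comm S.κ]
    have hw : 0 < √(S.d * S.κ * S.σ) := Real.sqrt_pos.2 (by positivity)
    have hw2 : √(S.d * S.κ * S.σ) ^ 2 = S.d * S.κ * S.σ := Real.sq_sqrt (by positivity)
    have l2' : ε * S.L ≤ √(S.d * S.κ * S.σ) ^ 2 := by
      rw [hw2]; rw [le_div_iff₀ h2] at l2; linarith
    have h6 : S.L * S.R ≤ √(S.d * S.κ * S.σ) * √D.Q := by
      calc S.L * S.R = ε * S.L * S.R / ε := by field_simp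
        _ ≤ √(S.d * S.κ * S.σ) ^ 2 * S.R / ε := by gcongr
        _ = √(S.d * S.κ * S.σ) * (S.R * √(S.d * S.κ * S.σ) / ε) := by ring
        _ ≤ √(S.d * S.κ * S.σ) * √D.Q := by
          gcongr
          refine le_trans (le_mul_of_one_le_right (by positivity) (by norm_num)) hnoise
    rw [e, div_le_div_iff₀ hQ hsqQ]
    nth_rewrite 2 [← Real.sq_sqrt hQ.le]
    calc S.L * S.R ^ 2 * √D.Q = S.L * S.R * (S.R * √D.Q) := by ring
      _ ≤ √(S.d * S.κ * S.σ) * √D.Q * (S.R * √D.Q) := by gcongr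
      _ = _ := by ring
  have hhle : D.h ≤ S.σ / S.L := by
    rw [← Real.rpow_le_rpow_iff hh0.le (by positivity) (show 0 < β - 1 by linarith)]
    refine le_of_mul_le_mul_left ?_ (mul_pos h1 h2)
    rw [S.smoothing_part_hStar (by linarith) hδ0]
    exact hule.trans (by rwa [div_le_iff₀' h4])
  have hδle : S.d * D.δ / D.h ≤ S.d * S.σ := by
    change S.d * δ / S.hStar δ ≤ _
    rw [S.noise_part_hStar (by linarith) hδ0]
    exact hule.trans (by rwa [div_le_iff₀' h4])
  have hE : S.errorBound D ≤ ε := by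
    refine (S.errorBound_le hQ hhle hδle hreg).trans ?_
    have t1 : S.L * S.R ^ 2 / (D.N : ℝ) ^ 2 ≤ ε / 8 := by
      change S.L * S.R ^ 2 / (N : ℝ) ^ 2 ≤ ε / 8
      calc S.L * S.R ^ 2 / (N : ℝ) ^ 2 ≤ S.L * S.R ^ 2 / (8 * X) := by
            gcongr; nlinarith
        _ = ε / 8 := by rw [hX]; field_simp
    have t2 : S.R / √D.Q * √(S.d * S.κ * S.σ) ≤ ε / 16 := by
      rw [div_mul_eq_mul_div, div_le_iff₀ hsqQ]
      calc _ = ε / 16 * (S.R * √(S.d * S.κ * S.σ) / ε * 16) := by field_simp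
        _ ≤ _ := by gcongr
    have t3 : S.biasI D.δ D.h ≤ ε / 8 := by
      change S.biasI δ (S.hStar δ) ≤ _
      rw [S.biasI_hStar (by linarith) hδ0, hu]
      have : s ≤ 1 / 16 := by rw [hs]; gcongr; linarith
      calc 2 * S.R * (s * (ε / S.R)) = 2 * s * ε := by field_simp
        _ ≤ 2 * (1 / 16) * ε := by gcongr
        _ = ε / 8 := by ring
    have t4 : S.biasII D.N D.δ D.h ≤ ε / 8 := by
      change S.biasII N δ (S.hStar δ) ≤ _
      rw [S.biasII_hStar (by linarith) N hδ0, hu]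
      calc 2 * (N : ℝ) * ((s * (ε / S.R)) ^ 2 / S.L)
          ≤ 2 * ((A + 1) * X) * ((s * (ε / S.R)) ^ 2 / S.L) := by gcongr
        _ = 1 / 8 * s * ε := by rw [hX, hs]; field_simp; norm_num
        _ ≤ 1 / 8 * 1 * ε := by gcongr
        _ = ε / 8 := by ring
    linarith
  refine ⟨D, ⟨⟨⟨Nat.cast_pos.1 hN0, Nat.cast_pos.1 hB0, hδ0, hh0, hE⟩, ?_, hreg⟩, rfl⟩, ?_⟩
  · exact le_trans (by gcongr; linarith) hNl
  · rw [D.time_eq, S.timeOrder_eq γ hε, hQdef]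
    change B * N * (τ * S.fidelityOrder ε) ^ (-γ) ≤ _
    rw [Real.mul_rpow hτ0.le hΦ.le]
    calc B * N * (τ ^ (-γ) * S.fidelityOrder ε ^ (-γ))
        ≤ 257 * Y * ((A + 1) * X) * (τ ^ (-γ) * S.fidelityOrder ε ^ (-γ)) := by gcongr
      _ = _ := by rw [← hQo, hXY]; ring

/-! ### Existence of minimizers -/

/-- A design of time at most `T` in the feasible set has all its coordinates in a compact box that
avoids `N = 0`, `B = 0`, `δ = 0` and `h = 0`. -/
theorem exists_box {γ ε T : ℝ} (hβ : 1 < β) (hγ : 0 < γ) (hε : 0 < ε) (hT : 0 < T) :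
    ∃ (n : ℕ) (δ₀ δ₁ h₀ h₁ : ℝ), 0 < δ₀ ∧ 0 < h₀ ∧
      ∀ D ∈ S.feasible ε, D.time γ ≤ T →
        (D.N ∈ Set.Icc 1 n ∧ D.B ∈ Set.Icc 1 n) ∧ D.δ ∈ Set.Icc δ₀ δ₁ ∧ D.h ∈ Set.Icc h₀ h₁ := by
  have h1 := S.κβ_pos; have h2 := S.L_pos; have h3 := S.cast_d_pos; have h4 := S.R_pos
  have hΦ := S.fidelityOrder_pos hε
  refine ⟨⌈T / S.fidelityOrder ε ^ (-γ)⌉₊, T ^ (-(1 / γ)), S.fidelityOrder ε,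
    S.R * S.d * T ^ (-(1 / γ)) / ε, (ε / (S.R * (S.κβ * S.L))) ^ (1 / (β - 1)),
    by positivity, by positivity, fun D hD hDT => ?_⟩
  have hδup := S.δ_le_of_feasible hβ hε hD
  have hI := (S.terms_le_of_feasible hD).2.1
  obtain ⟨hN, hB, hδ, hh, -⟩ := hD
  rw [D.time_eq] at hDT
  have hδΦ := Real.rpow_le_rpow_of_nonpos hδ hδup (neg_nonpos.2 hγ.le)
  have hΦγ : 0 < S.fidelityOrder ε ^ (-γ) := by positivity
  have hδγ : 0 < D.δ ^ (-γ) := by positivity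
  have hNR : (1 : ℝ) ≤ D.N := by exact_mod_cast hN
  have hBR : (1 : ℝ) ≤ D.B := by exact_mod_cast hB
  have hQ1 : 1 ≤ D.Q := by unfold Design.Q; nlinarith
  have hQT : D.Q ≤ T / S.fidelityOrder ε ^ (-γ) := by
    rw [le_div_iff₀ hΦγ]
    exact le_trans (by gcongr) hDT
  have hQc : D.Q ≤ (⌈T / S.fidelityOrder ε ^ (-γ)⌉₊ : ℝ) := hQT.trans (Nat.le_ceil _)
  have hδlow : T ^ (-(1 / γ)) ≤ D.δ := by
    rw [← Real.rpow_le_rpow_iff_of_neg hδ (by positivity) (neg_lt_zero.2 hγ),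
      ← Real.rpow_mul hT.le, show -(1 / γ) * -γ = 1 by field_simp, Real.rpow_one]
    exact le_trans (le_mul_of_one_le_left hδγ.le hQ1) hDT
  have hv0 : 0 < S.d * D.δ / D.h := by positivity
  have hs0 : 0 < S.κβ * S.L * D.h ^ (β - 1) := by positivity
  unfold biasI at hI
  refine ⟨⟨⟨hN, ?_⟩, ⟨hB, ?_⟩⟩, ⟨hδlow, hδup⟩, ?_, ?_⟩
  · have : (D.N : ℝ) ≤ D.Q := by unfold Design.Q; nlinarith
    exact_mod_cast this.trans hQc
  · have : (D.B : ℝ) ≤ D.Q := by unfold Design.Q; nlinarith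
    exact_mod_cast this.trans hQc
  · have h6 : S.R * (S.d * D.δ / D.h) ≤ ε := by nlinarith
    rw [mul_div_assoc', div_le_iff₀ hh] at h6
    rw [div_le_iff₀ hε]
    calc S.R * S.d * T ^ (-(1 / γ)) ≤ S.R * S.d * D.δ := by gcongr
      _ ≤ D.h * ε := by linarith
  · have h6 : S.R * (S.κβ * S.L * D.h ^ (β - 1)) ≤ ε := by nlinarith
    have hb : 0 < β - 1 := by linarith
    rw [← Real.rpow_le_rpow_iff hh.le (by positivity) hb, ← Real.rpow_mul (by positivity),
      one_div_mul_cancel hb.ne', Real.rpow_one, le_div_iff₀ (by positivity)]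
    linarith

theorem continuousOn_errorBound :
    ContinuousOn (fun x => S.errorBound (Design.ofProd x))
      {x : ℕ × ℕ × ℝ × ℝ | 0 < x.1 ∧ 0 < x.2.1 ∧ 0 < x.2.2.1 ∧ 0 < x.2.2.2} := by
  have h2 := S.L_pos
  unfold errorBound biasI biasII Design.Q Design.ofProd
  have cN : Continuous fun x : ℕ × ℕ × ℝ × ℝ => (x.1 : ℝ) :=
    continuous_of_discreteTopology.comp continuous_fst
  have cB : Continuous fun x : ℕ × ℕ × ℝ × ℝ => (x.2.1 : ℝ) :=
    continuous_of_discreteTopology.comp (continuous_fst.comp continuous_snd)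
  rintro x ⟨hN, hB, hδ, hh⟩
  have hN' : (0 : ℝ) < x.1 := Nat.cast_pos.2 hN
  have hB' : (0 : ℝ) < x.2.1 := Nat.cast_pos.2 hB
  apply ContinuousAt.continuousWithinAt
  have cN := cN.continuousAt (x := x)
  have cB := cB.continuousAt (x := x)
  have ch : ContinuousAt (fun x : ℕ × ℕ × ℝ × ℝ => x.2.2.2) x := by fun_prop
  have cδ : ContinuousAt (fun x : ℕ × ℕ × ℝ × ℝ => x.2.2.1) x := by fun_prop
  have chp := fun p : ℝ => ch.rpow_const (p := p) (Or.inl hh.ne')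
  have c₁ := chp (β - 1)
  have c₂ := chp (2 * (β - 1))
  have c₃ := cδ.const_mul (S.d : ℝ)
  have hQ := (mul_pos hB' hN').ne'
  have hN2 := (pow_pos hN' 2).ne'
  have hQs := (Real.sqrt_pos.2 (mul_pos hB' hN')).ne'
  have hhL := (mul_pos h2 (pow_pos hh 2)).ne'
  have c₄ := c₃.div ch hh.ne'
  refine ((((continuousAt_const.div (cN.pow 2) hN2).add
    (continuousAt_const.div (cB.mul cN) hQ)).add
    ((continuousAt_const.div (cB.mul cN).sqrt hQs).mul
      ((continuousAt_const.add (ch.const_mul _).sqrt).add (c₄.const_mul _).sqrt))).add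
    (((c₁.const_mul _).add c₄).const_mul _)).add
    (cN.mul ((c₂.const_mul _).add (((cδ.pow 2).const_mul _).div ((ch.pow 2).const_mul _) hhL)))

/-- A minimizer exists in the regime under any additional constraint on `(δ, h)` that is closed in
the open quadrant, given as the zero set of `g`. -/
theorem exists_isOptimal {γ ν ε : ℝ} (hβ : 1 < β) (hγ : 0 < γ) (hε : 0 < ε) {g : ℝ × ℝ → ℝ}
    (hg : ContinuousOn g (Set.Ioi 0 ×ˢ Set.Ioi 0)) {D₀ : Design}
    (hD₀ : D₀ ∈ S.feasible ε ∩ S.largeRegime ν ε ∩ {D | g (D.δ, D.h) = 0}) :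
    ∃ D, IsOptimal γ (S.feasible ε ∩ S.largeRegime ν ε ∩ {D | g (D.δ, D.h) = 0}) D := by
  set F := S.feasible ε ∩ S.largeRegime ν ε ∩ {D | g (D.δ, D.h) = 0} with hF
  have hT0 : 0 < D₀.time γ :=
    (S.timeOrder_pos γ hε).trans_le (S.timeOrder_le_of_feasible hβ hγ hε hD₀.1.1)
  obtain ⟨n, δ₀, δ₁, h₀, h₁, hδ₀, hh₀, hbox⟩ := S.exists_box hβ hγ hε hT0
  set box : Set (ℕ × ℕ × ℝ × ℝ) :=
    Set.Icc 1 n ×ˢ Set.Icc 1 n ×ˢ Set.Icc δ₀ δ₁ ×ˢ Set.Icc h₀ h₁ with hboxdef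
  have hcomp : IsCompact box :=
    (Set.finite_Icc 1 n).isCompact.prod
      ((Set.finite_Icc 1 n).isCompact.prod (isCompact_Icc.prod isCompact_Icc))
  have hsub : ∀ x ∈ box, 0 < x.1 ∧ 0 < x.2.1 ∧ 0 < x.2.2.1 ∧ 0 < x.2.2.2 := fun x hx =>
    ⟨hx.1.1, hx.2.1.1, hδ₀.trans_le hx.2.2.1.1, hh₀.trans_le hx.2.2.2.1⟩
  have cE := S.continuousOn_errorBound.mono hsub
  have cg : ContinuousOn (fun x : ℕ × ℕ × ℝ × ℝ => g (x.2.2.1, x.2.2.2)) box :=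
    hg.comp (by fun_prop) fun x hx => ⟨(hsub x hx).2.2.1, (hsub x hx).2.2.2⟩
  -- the regime constrains only `N` and `B`, which are discrete
  have hreg : IsClosed {x : ℕ × ℕ × ℝ × ℝ | Design.ofProd x ∈ S.largeRegime ν ε} := by
    have : {x : ℕ × ℕ × ℝ × ℝ | Design.ofProd x ∈ S.largeRegime ν ε} =
        (fun x : ℕ × ℕ × ℝ × ℝ => (x.1, x.2.1)) ⁻¹'
          {y : ℕ × ℕ | (⟨y.1, y.2, 0, 0⟩ : Design) ∈ S.largeRegime ν ε} := rfl
    rw [this]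
    exact (isClosed_discrete _).preimage (by fun_prop)
  set A := box ∩ {x | Design.ofProd x ∈ F} with hA
  have hAeq : A = (box ∩ (fun x => S.errorBound (Design.ofProd x)) ⁻¹' Set.Iic ε) ∩
      {x | Design.ofProd x ∈ S.largeRegime ν ε} ∩
      (box ∩ (fun x : ℕ × ℕ × ℝ × ℝ => g (x.2.2.1, x.2.2.2)) ⁻¹' {0}) := by
    ext x
    constructor
    · rintro ⟨hx, ⟨hf, hr⟩, hgx⟩
      exact ⟨⟨⟨hx, hf.2.2.2.2⟩, hr⟩, hx, hgx⟩
    · rintro ⟨⟨⟨hx, he⟩, hr⟩, -, hgx⟩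
      obtain ⟨p1, p2, p3, p4⟩ := hsub x hx
      exact ⟨hx, ⟨⟨p1, p2, p3, p4, he⟩, hr⟩, hgx⟩
  have hAcomp : IsCompact A := by
    refine hcomp.of_isClosed_subset ?_ Set.inter_subset_left
    rw [hAeq]
    exact ((cE.preimage_isClosed_of_isClosed hcomp.isClosed isClosed_Iic).inter hreg).inter
      (cg.preimage_isClosed_of_isClosed hcomp.isClosed isClosed_singleton)
  have hmem : ∀ D ∈ F, D.time γ ≤ D₀.time γ → (D.N, D.B, D.δ, D.h) ∈ A := fun D hD hDT => by
    obtain ⟨⟨a, b⟩, c, e⟩ := hbox D hD.1.1 hDT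
    exact ⟨⟨a, b, c, e⟩, hD⟩
  have ct : ContinuousOn (fun x => (Design.ofProd x).time γ) A := by
    simp only [Design.time_eq]
    refine ContinuousOn.mul ?_ ?_
    · unfold Design.Q Design.ofProd
      have cN : Continuous fun x : ℕ × ℕ × ℝ × ℝ => (x.1 : ℝ) :=
        continuous_of_discreteTopology.comp continuous_fst
      have cB : Continuous fun x : ℕ × ℕ × ℝ × ℝ => (x.2.1 : ℝ) :=
        continuous_of_discreteTopology.comp (continuous_fst.comp continuous_snd)
      exact (cB.mul cN).continuousOn
    · refine ContinuousOn.rpow_const ?_ fun x hx => Or.inl (hsub x hx.1).2.2.1.ne'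
      unfold Design.ofProd
      fun_prop
  obtain ⟨x, hx, hmin⟩ := hAcomp.exists_isMinOn ⟨_, hmem D₀ hD₀ le_rfl⟩ ct
  refine ⟨Design.ofProd x, hx.2, fun D hD => ?_⟩
  have hx₀ : (Design.ofProd x).time γ ≤ D₀.time γ := hmin (hmem D₀ hD₀ le_rfl)
  rcases le_total (D.time γ) (D₀.time γ) with h | h
  · exact hmin (hmem D hD h)
  · exact hx₀.trans h

theorem continuousOn_hStar (hβ : 0 < β) : ContinuousOn S.hStar (Set.Ioi 0) := by
  unfold hStar
  refine ContinuousOn.rpow_const (by fun_prop) fun x _ => Or.inr (by positivity)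

end Setting
end AdvZOSGD

theorem mainTheorem9 (β γ ν : ℝ) (hβ : 2 ≤ β) (hγ : 0 < γ) (hν : 0 < ν) :
    ∃ c C : ℝ, 0 < c ∧ 0 < C ∧ ∀ S : AdvZOSGD.Setting β,
      -- with the balanced radius, the two bias terms are the two fidelity channels
      (∀ (N : ℕ) (δ : ℝ), 0 < δ →
        S.biasI δ (S.hStar δ) = 2 * S.R * S.a₁ * δ ^ ((β - 1) / β) ∧
        S.biasII N δ (S.hStar δ) = 2 * N * S.a₂ * δ ^ (2 * ((β - 1) / β))) ∧
      ∃ ε₀ : ℝ, 0 < ε₀ ∧ ∀ ε : ℝ, 0 < ε → ε ≤ ε₀ →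
        -- optimal designs among those with the balanced radius `h = h*(δ)`
        ((∃ D, AdvZOSGD.IsOptimal γ (S.feasible ε ∩ S.largeRegime ν ε ∩ S.balanced) D) ∧
          ∀ D, AdvZOSGD.IsOptimal γ (S.feasible ε ∩ S.largeRegime ν ε ∩ S.balanced) D →
            AdvZOSGD.HasClaimedOrders S γ c C ε D) ∧
        -- optimal designs when the radius `h` is optimized as well
        ((∃ D, AdvZOSGD.IsOptimal γ (S.feasible ε ∩ S.largeRegime ν ε) D) ∧
          ∀ D, AdvZOSGD.IsOptimal γ (S.feasible ε ∩ S.largeRegime ν ε) D →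
            AdvZOSGD.HasClaimedOrders S γ c C ε D) ∧
        -- outside the large-`N` regime nothing of smaller order is possible
        (∀ D ∈ S.feasible ε, c * S.timeOrder γ ε ≤ D.time γ) := by
  have hβ1 : 1 < β := by linarith
  have hβ0 : 0 < β := by linarith
  obtain ⟨M, hM⟩ : ∃ M : ℝ, M = 257 * ((ν + 1) + 1) *
      ((1 / (16 * ((ν + 1) + 1))) ^ (β / (β - 1))) ^ (-γ) := ⟨_, rfl⟩
  have hM0 : 0 < M := by rw [hM]; positivity
  obtain ⟨m, hm⟩ : ∃ m : ℝ, m = M ^ (-(1 / γ)) := ⟨_, rfl⟩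
  have hm0 : 0 < m := by rw [hm]; positivity
  obtain ⟨c, hc0, hc⟩ : ∃ c : ℝ, 0 < c ∧ c ≤ 1 ∧ c ≤ ν ∧ c ≤ m ∧
      c ≤ (m ^ ((β - 1) / β)) ^ 2 ∧ c ≤ m ^ ((β - 1) / β) := by
    refine ⟨min 1 (min ν (min m (min ((m ^ ((β - 1) / β)) ^ 2) (m ^ ((β - 1) / β))))), ?_, ?_⟩
    · simp only [lt_min_iff]
      refine ⟨?_, ?_, ?_, ?_, ?_⟩ <;> positivity
    · simp only [← le_min_iff, le_refl]
  obtain ⟨C, hC⟩ : ∃ C : ℝ, 1 ≤ C ∧ M ≤ C ∧ ((m ^ ((β - 1) / β)) ^ 2)⁻¹ ≤ C ∧ M / ν ≤ C ∧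
      m ^ (-(1 / β)) ≤ C := by
    refine ⟨max 1 (max M (max (((m ^ ((β - 1) / β)) ^ 2)⁻¹) (max (M / ν) (m ^ (-(1 / β)))))), ?_⟩
    simp only [← max_le_iff, le_refl]
  refine ⟨c, C, hc0, by linarith [hC.1], fun S => ⟨fun N δ hδ => ⟨?_, ?_⟩, S.accuracyThreshold,
    S.accuracyThreshold_pos, fun ε hε hε₀ => ?_⟩⟩
  · rw [S.biasI_hStar hβ0 hδ, AdvZOSGD.Setting.biasLevel]; ring
  · rw [S.biasII_hStar hβ0 N hδ, ← S.a₂_mul_rpow hδ]; ring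
  obtain ⟨D₀, hD₀, hT⟩ := S.exists_feasible_time_le (γ := γ) hβ1 hν rfl hε hε₀
  rw [← hM] at hT
  -- the same design `D₀`, balanced and in the regime, is a competitor in both problems
  have horders : ∀ F ⊆ S.feasible ε ∩ S.largeRegime ν ε, D₀ ∈ F →
      ∀ D, AdvZOSGD.IsOptimal γ F D → AdvZOSGD.HasClaimedOrders S γ c C ε D :=
    fun F hF h₀ D hD => S.hasClaimedOrders_of_time_le hβ1 hγ hν hM0 hm hc hC hε (hF hD.1).1
      (hF hD.1).2 (le_trans (hD.2 h₀) hT)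
  have hbal : S.balanced = {D | (fun x : ℝ × ℝ => x.2 - S.hStar x.1) (D.δ, D.h) = 0} := by
    ext D; exact sub_eq_zero.symm
  refine ⟨⟨?_, horders _ Set.inter_subset_left hD₀⟩, ⟨?_, horders _ subset_rfl hD₀.1⟩,
    fun D hD => ?_⟩
  · rw [hbal] at hD₀ ⊢
    refine S.exists_isOptimal (g := fun x : ℝ × ℝ => x.2 - S.hStar x.1) hβ1 hγ hε
      (continuousOn_snd.sub ?_) hD₀
    exact (S.continuousOn_hStar hβ0).comp (by fun_prop) fun x hx => hx.1
  · have := S.exists_isOptimal (γ := γ) (ν := ν) (D₀ := D₀) hβ1 hγ hε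
      (continuousOn_const (c := (0 : ℝ))) ⟨hD₀.1, rfl⟩
    simpa using this
  · exact le_trans (mul_le_of_le_one_left (S.timeOrder_pos γ hε).le hc.1)
      (S.timeOrder_le_of_feasible hβ1 hγ hε hD)
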